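/- For a finite simple connected graph $G$ the Harary index is $H(G)=\sum_{\{u,v\}}\frac{1}{d(u,v)}$, where the sum goes over all unordered pairs of distinct vertices and $d(u,v)$ is the distance in $G$; the diameter of $G$ is the largest distance between two of its vertices. Let $n,d$ be integers with $d\ge 2$ and $n\ge d+1$, or with $d\in\{0,1\}$ and $n=d+1$ (these are exactly the pairs for which a tree with $n$ vertices and diameter $d$ exists). Let $C_{n,d,\lfloor d/2\rfloor}$ be the caterpillar obtained from a path $v_0v_1\cdots v_d$ by attaching $n-d-1$ pendant vertices to the vertex $v_{\lfloor d/2\rfloor}$. Theorem 3.7. Among trees with $n$ vertices and diameter $d$, the caterpillar $C_{n,d,\lfloor d/2\rfloor}$ is the unique tree with maximal Harary index. That is, $C_{n,d,\lfloor d/2\rfloor}$ is a tree with $n$ vertices and diameter $d$, and every tree $T$ with $n$ vertices and diameter $d$ satisfies $$H(T)\le H(C_{n,d,\lfloor d/2\rfloor}),$$ with equality if and only if $T$ is isomorphic to $C_{n,d,\lfloor d/2\rfloor}$. -/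

import Mathlib

namespace HararyTree

/-- The reciprocal distance matrix (Harary matrix) of a graph: the `(u, v)` entry is `1 / d(u, v)`.
The diagonal entries are `0⁻¹ = 0`, as they should be. -/
noncomputable def reciprocalDistMatrix {V : Type*} (G : SimpleGraph V) : Matrix V V ℝ :=
  Matrix.of fun u v => ((G.dist u v : ℝ))⁻¹

/-- The Harary index: the half-sum of the entries of the reciprocal distance matrix, that is, the
sum of `1 / d(u, v)` over all unordered pairs of distinct vertices. -/
noncomputable def hararyIndex {V : Type*} [Fintype V] (G : SimpleGraph V) : ℝ :=
  (1 / 2) * ∑ u, ∑ v, reciprocalDistMatrix G u v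

/-- The caterpillar `C_{n,d,i}`: a path `v_0 v_1 … v_d` (the left summand) together with `n - d - 1`
further vertices (the right summand), each of them a pendant vertex attached to `v_i`.
Meaningful for `d + 1 ≤ n` and `i ≤ d`. -/
def caterpillar (n d i : ℕ) : SimpleGraph (Fin (d + 1) ⊕ Fin (n - d - 1)) where
  Adj
    | Sum.inl a, Sum.inl b => (SimpleGraph.pathGraph (d + 1)).Adj a b
    | Sum.inl a, Sum.inr _ => (a : ℕ) = i
    | Sum.inr _, Sum.inl a => (a : ℕ) = i
    | Sum.inr _, Sum.inr _ => False
  symm := ⟨by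
    rintro (a | a) (b | b) h
    · exact SimpleGraph.Adj.symm h
    · exact h
    · exact h
    · exact h⟩
  loopless := ⟨by
    rintro (a | a) h
    · exact SimpleGraph.irrefl _ h
    · exact h⟩

end HararyTree

namespace HararyTree

open SimpleGraph

/-! ### Distances and geodesics in trees. -/

section TreeDist

variable {V : Type*} {G : SimpleGraph V}

/-! Fix a diametral path `p 0, …, p d` and split the sum over ordered pairs: path pairs give a
constant, and there remain the pairs with one or two vertices off the path. An off-path vertex
projects to some `p j` at some height `h`. At height 1 its sum of reciprocal distances to the path
is largest exactly for `j` central, by concavity of harmonic sums.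

Two off-path vertices contribute at most 1/2 in each order unless adjacent, when they exceed this by
1 in total. Charge that excess to the endpoint farther from `p 0`. Each vertex is charged at most
once, and never at height 1, since its parent then lies on the path. At height at least 2, twice the
path sum has lost more than 1 (`pathSum_add_half_lt`), which outweighs the charge.

Equality thus forces all off-path vertices to height 1 at a centre, at mutual distance 2, hence all
at the same centre. For odd `d` the two centres are exchanged by reversing the path. -/

/-- In a tree, a vertex has at most one neighbour that is closer to a given vertex `w`. -/
theorem eq_of_adj_of_dist_succ (hG : G.IsTree) {w u v x : V} (hu : G.Adj u x) (hv : G.Adj v x)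
    (hdu : G.dist w u + 1 = G.dist w x) (hdv : G.dist w v + 1 = G.dist w x) : u = v := by
  obtain ⟨p, hp⟩ := hG.connected.exists_walk_length_eq_dist w u
  obtain ⟨q, hq⟩ := hG.connected.exists_walk_length_eq_dist w v
  have hp' : (p.concat hu).IsPath := Walk.isPath_of_length_eq_dist _ (by simp [hp, hdu])
  have hq' : (q.concat hv).IsPath := Walk.isPath_of_length_eq_dist _ (by simp [hq, hdv])
  have h := (hG.existsUnique_path w x).unique hp' hq'
  simpa using congrArg Walk.penultimate h

/-- A graph is acyclic as soon as its vertices can be ranked in such a way that every vertex has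
at most one neighbour that is not of larger rank. -/
theorem isAcyclic_of_rank (r : V → ℕ)
    (h : ∀ u v x, G.Adj x u → G.Adj x v → r u ≤ r x → r v ≤ r x → u = v) : G.IsAcyclic := by
  classical
  intro a c hc
  obtain ⟨x, hx, hmax⟩ := c.support.toFinset.exists_max_image r ⟨a, by simp⟩
  rw [List.mem_toFinset] at hx
  have hc' := hc.rotate hx
  have hsupp : ∀ y ∈ (c.rotate x hx).support, r y ≤ r x := fun y hy =>
    hmax y (List.mem_toFinset.2 (by simpa using hy))
  refine hc'.snd_ne_penultimate (h _ _ x ?_ ?_ (hsupp _ ?_) (hsupp _ ?_))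
  · exact Walk.adj_snd hc'.not_nil
  · exact (Walk.adj_penultimate hc'.not_nil).symm
  · exact Walk.getVert_mem_support _ _
  · exact Walk.getVert_mem_support _ _

/-- A function with the local behaviour of a distance function is the distance function, and the
graph is connected. -/
theorem connected_and_dist_eq [Nonempty V] (δ : V → V → ℕ) (h0 : ∀ x, δ x x = 0)
    (hle : ∀ x u v, G.Adj u v → δ x v ≤ δ x u + 1)
    (hpred : ∀ x y, x ≠ y → ∃ z, G.Adj z y ∧ δ x z + 1 = δ x y) :
    G.Connected ∧ ∀ x y, G.dist x y = δ x y := by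
  -- Descending through predecessors yields a walk of length `δ x y`, so the distance is at most
  -- `δ`; `hwalk` gives the converse.
  have hex : ∀ n x y, δ x y = n → ∃ p : G.Walk x y, p.length = n := by
    intro n
    induction n with
    | zero =>
      intro x y hxy
      by_cases h : x = y
      · subst h
        exact ⟨Walk.nil, rfl⟩
      · obtain ⟨z, -, hz⟩ := hpred x y h
        omega
    | succ n ih =>
      intro x y hxy
      have h : x ≠ y := by
        rintro rfl
        rw [h0] at hxy
        omega
      obtain ⟨z, hz, hd⟩ := hpred x y h
      obtain ⟨p, hp⟩ := ih x z (by omega)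
      exact ⟨p.concat hz, by simp [hp]⟩
  have hwalk : ∀ x u v (p : G.Walk u v), δ x v ≤ δ x u + p.length := by
    intro x u v p
    induction p with
    | nil => simp
    | cons hadj p ih =>
      have := hle x _ _ hadj
      rw [Walk.length_cons]
      omega
  have hconn : G.Connected := ⟨fun x y => (hex _ x y rfl).choose.reachable⟩
  refine ⟨hconn, fun x y => le_antisymm ?_ ?_⟩
  · obtain ⟨p, hp⟩ := hex _ x y rfl
    exact hp ▸ dist_le p
  · obtain ⟨p, hp⟩ := hconn.exists_walk_length_eq_dist x y
    have := hwalk x x y p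
    rw [h0] at this
    omega

theorem diam_eq_of_forall_dist_le [Finite V] (hG : G.Connected) {d : ℕ}
    (hle : ∀ x y, G.dist x y ≤ d) (hex : ∃ x y, G.dist x y = d) : G.diam = d := by
  have := hG.nonempty
  have htop : G.ediam ≠ ⊤ := connected_iff_ediam_ne_top.1 hG
  obtain ⟨x, y, hxy⟩ := G.exists_dist_eq_diam
  obtain ⟨x', y', hxy'⟩ := hex
  have h1 := dist_le_diam htop (u := x') (v := y')
  have h2 := hle x y
  omega

/-- The vertices `p 0, …, p d` are at the distances that they would have on a path. -/
def IsGeodesic (G : SimpleGraph V) (d : ℕ) (p : ℕ → V) : Prop :=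
  ∀ i ≤ d, ∀ j ≤ d, G.dist (p i) (p j) = Nat.dist i j

/-- Along a shortest walk realising the diameter, the triangle inequality between its ends leaves no
slack for any intermediate pair. -/
theorem exists_isGeodesic [Finite V] (hG : G.Connected) :
    ∃ p, IsGeodesic G G.diam p := by
  have := hG.nonempty
  obtain ⟨x, y, hxy⟩ := G.exists_dist_eq_diam
  obtain ⟨w, hw⟩ := hG.exists_walk_length_eq_dist x y
  have hlen : ∀ i j, G.dist (w.getVert i) (w.getVert (i + j)) ≤ j := by
    intro i j
    induction j with
    | zero => simp
    | succ j ih =>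
      have h1 := hG.dist_triangle (u := w.getVert i) (v := w.getVert (i + j))
        (w := w.getVert (i + (j + 1)))
      have h2 : G.dist (w.getVert (i + j)) (w.getVert (i + (j + 1))) ≤ 1 := by
        by_cases h : i + j < w.length
        · exact (dist_eq_one_iff_adj.2 (w.adj_getVert_succ h)).le
        · rw [w.getVert_of_length_le (by omega), w.getVert_of_length_le (by omega)]
          simp
      omega
  have key : ∀ i j, i ≤ j → j ≤ G.diam → G.dist (w.getVert i) (w.getVert j) = j - i := by
    intro i j hij hj
    have h0 := hlen 0 i
    have h1 := hlen i (j - i)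
    have h2 := hlen j (G.diam - j)
    have h3 := hG.dist_triangle (u := x) (v := w.getVert i) (w := y)
    have h4 := hG.dist_triangle (u := w.getVert i) (v := w.getVert j) (w := y)
    rw [Nat.zero_add, Walk.getVert_zero] at h0
    rw [Nat.add_sub_cancel' hij] at h1
    rw [Nat.add_sub_cancel' hj, ← hxy, ← hw, Walk.getVert_length] at h2
    omega
  refine ⟨w.getVert, fun i hi j hj => ?_⟩
  rcases le_total i j with h | h
  · rw [key i j h hj, Nat.dist_eq_sub_of_le h]
  · rw [dist_comm, key j i h hi, Nat.dist_eq_sub_of_le_right h]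

theorem IsGeodesic.reverse {d : ℕ} {p : ℕ → V} (hp : IsGeodesic G d p) :
    IsGeodesic G d (fun i => p (d - i)) := by
  intro i hi j hj
  have := hp (d - i) (by omega) (d - j) (by omega)
  simp only [this, Nat.dist]
  omega

theorem IsGeodesic.adj {d : ℕ} {p : ℕ → V} (hp : IsGeodesic G d p) {i : ℕ} (hi : i < d) :
    G.Adj (p i) (p (i + 1)) := by
  rw [← dist_eq_one_iff_adj, hp i hi.le (i + 1) hi, Nat.dist]
  omega

theorem IsGeodesic.injOn {d : ℕ} {p : ℕ → V} (hp : IsGeodesic G d p) {i j : ℕ} (hi : i ≤ d)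
    (hj : j ≤ d) (h : p i = p j) : i = j := by
  have := hp i hi j hj
  rw [h, dist_self] at this
  exact Nat.eq_of_dist_eq_zero this.symm

theorem IsGeodesic.injOn_range {d : ℕ} {p : ℕ → V} (hp : IsGeodesic G d p) :
    Set.InjOn p (Finset.range (d + 1)) := by
  intro a ha b hb h
  simp only [Finset.coe_range, Set.mem_Iio, Nat.lt_succ_iff] at ha hb
  exact hp.injOn ha hb h

/-- A sequence with steps `±1` and without peaks first goes down and then goes up. -/
theorem exists_eq_add_dist (a : ℕ → ℕ) (d : ℕ)
    (hstep : ∀ i < d, a (i + 1) = a i + 1 ∨ a i = a (i + 1) + 1)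
    (hpeak : ∀ i, i + 2 ≤ d → a (i + 1) = a i + 1 → a (i + 1) ≠ a (i + 2) + 1) :
    ∃ j ≤ d, ∀ i ≤ d, a i = a j + Nat.dist i j := by
  simp only [Nat.dist]
  induction d with
  | zero => exact ⟨0, le_rfl, fun i hi => by simp [Nat.le_zero.1 hi]⟩
  | succ d ih =>
    obtain ⟨j, hj, h⟩ := ih (fun i hi => hstep i (by omega)) (fun i hi => hpeak i (by omega))
    have hd := hstep d (by omega)
    by_cases hup : a (d + 1) = a d + 1
    · refine ⟨j, by omega, fun i hi => ?_⟩
      rcases Nat.lt_or_ge d i with hi' | hi'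
      · obtain rfl : i = d + 1 := by omega
        have := h d le_rfl
        omega
      · exact h i hi'
    -- If the minimum came before `d`, the sequence would be rising at `d`, and a final descent
    -- would make `d` a peak.
    · have hjd : j = d := by
        by_contra hne
        obtain ⟨e, rfl⟩ : ∃ e, d = e + 1 := ⟨d - 1, by omega⟩
        have h1 := h e (by omega)
        have h2 := h (e + 1) le_rfl
        have : a (e + 1) ≠ a (e + 1 + 1) + 1 := hpeak e (by omega) (by omega)
        omega
      subst hjd
      refine ⟨j + 1, le_rfl, fun i hi => ?_⟩
      rcases Nat.lt_or_ge j i with hi' | hi'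
      · obtain rfl : i = j + 1 := by omega
        omega
      · have := h i hi'
        omega

/-- In a tree, every vertex has a projection to a geodesic. -/
theorem IsGeodesic.exists_proj (hG : G.IsTree) {d : ℕ} {p : ℕ → V} (hp : IsGeodesic G d p)
    (w : V) : ∃ j ≤ d, ∀ i ≤ d, G.dist w (p i) = G.dist w (p j) + Nat.dist i j := by
  refine exists_eq_add_dist (fun i => G.dist w (p i)) d (fun i hi => ?_) (fun i hi h1 h2 => ?_)
  · have := hG.dist_eq_dist_add_one_of_adj w (hp.adj hi)
    tauto
  -- At a peak, both path neighbours would be closer to `w`, hence equal.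
  · have h := eq_of_adj_of_dist_succ hG (hp.adj (by omega : i < d))
      (hp.adj (by omega : i + 1 < d)).symm h1.symm h2.symm
    have := hp.injOn (by omega) (by omega) h
    omega

end TreeDist

/-! ### Structure of the caterpillar. -/

/-- The position on the path `v_0 … v_d` to which a vertex of the caterpillar projects. -/
def catPos {n d : ℕ} (i : ℕ) : Fin (d + 1) ⊕ Fin (n - d - 1) → ℕ
  | Sum.inl a => a
  | Sum.inr _ => i

/-- The distance of a vertex of the caterpillar from the path `v_0 … v_d`. -/
def catHeight {n d : ℕ} : Fin (d + 1) ⊕ Fin (n - d - 1) → ℕ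
  | Sum.inl _ => 0
  | Sum.inr _ => 1

theorem caterpillar_isAcyclic (n d i : ℕ) : (caterpillar n d i).IsAcyclic := by
  refine isAcyclic_of_rank (Sum.elim (fun a => (a : ℕ)) (fun _ => d + 1)) ?_
  rintro (u | u) (v | v) (x | x) hu hv <;>
    simp only [caterpillar, pathGraph_adj] at hu hv <;>
    simp only [Sum.elim_inl, Sum.elim_inr, Sum.inl.injEq, reduceCtorEq, Sum.inr.injEq,
      Fin.ext_iff] <;>
    omega

theorem caterpillar_connected_and_dist (n d i : ℕ) (hi : i ≤ d) :
    (caterpillar n d i).Connected ∧ ∀ x y, (caterpillar n d i).dist x y =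
      if x = y then 0 else Nat.dist (catPos i x) (catPos i y) + catHeight x + catHeight y := by
  refine connected_and_dist_eq _ (by simp) ?_ ?_
  · rintro (x | x) (u | u) (v | v) h <;>
      simp only [caterpillar, pathGraph_adj] at h <;>
      simp only [catPos, catHeight, Nat.dist, Sum.inl.injEq, reduceCtorEq, Sum.inr.injEq,
        Fin.ext_iff, if_false] <;>
      (try split_ifs) <;> omega
  · have hstep : ∀ (x : Fin (d + 1) ⊕ Fin (n - d - 1)) (y : Fin (d + 1)), x ≠ Sum.inl y →
        ∃ z, (caterpillar n d i).Adj z (Sum.inl y) ∧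
        (if x = z then 0 else Nat.dist (catPos i x) (catPos i z) + catHeight x + catHeight z) + 1 =
        (if x = Sum.inl y then 0 else
          Nat.dist (catPos i x) (catPos (n := n) i (Sum.inl y)) + catHeight x +
            catHeight (n := n) (Sum.inl y)) := by
      intro x y hxy
      have hy := y.2
      rcases lt_trichotomy (catPos i x) (y : ℕ) with h | h | h
      · refine ⟨Sum.inl ⟨y - 1, by omega⟩, ?_, ?_⟩
        · simp only [caterpillar, pathGraph_adj]
          omega
        · rcases x with x | x <;>
          simp only [catPos, catHeight, Nat.dist, Sum.inl.injEq, reduceCtorEq,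
            Fin.ext_iff, if_false] at h ⊢ <;>
          (try split_ifs) <;> omega
      · rcases x with x | x
        · exact absurd (congrArg Sum.inl (Fin.ext h)) hxy
        · exact ⟨Sum.inr x, h.symm, by simp [catPos, catHeight, Nat.dist] at h ⊢; omega⟩
      · have hx : catPos i x ≤ d := by
          rcases x with x | x
          · exact Nat.lt_succ_iff.1 x.2
          · exact hi
        refine ⟨Sum.inl ⟨y + 1, by omega⟩, ?_, ?_⟩
        · simp only [caterpillar, pathGraph_adj]
          simp
        · rcases x with x | x <;>
          simp only [catPos, catHeight, Nat.dist, Sum.inl.injEq, reduceCtorEq,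
            Fin.ext_iff, if_false] at h ⊢ <;>
          (try split_ifs) <;> omega
    rintro x (y | y) hxy
    · exact hstep x y hxy
    · refine ⟨Sum.inl ⟨i, by omega⟩, rfl, ?_⟩
      rw [if_neg hxy]
      rcases x with x | x <;>
        simp only [catPos, catHeight, Nat.dist, Sum.inl.injEq, reduceCtorEq,
            Fin.ext_iff, if_false]
      split_ifs <;> omega

theorem caterpillar_isTree (n d i : ℕ) (hi : i ≤ d) : (caterpillar n d i).IsTree :=
  ⟨(caterpillar_connected_and_dist n d i hi).1, caterpillar_isAcyclic n d i⟩

theorem caterpillar_dist (n d i : ℕ) (hi : i ≤ d) (x y : Fin (d + 1) ⊕ Fin (n - d - 1)) :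
    (caterpillar n d i).dist x y =
      if x = y then 0 else Nat.dist (catPos i x) (catPos i y) + catHeight x + catHeight y :=
  (caterpillar_connected_and_dist n d i hi).2 x y

/-- For `d ≤ 1` a pendant vertex could lengthen the path, so none is allowed; for `d ≥ 2` the centre
is far enough from both ends. -/
theorem caterpillar_diam (n d : ℕ) (hnd : 2 ≤ d ∨ n = d + 1) :
    (caterpillar n d (d / 2)).diam = d := by
  have hd : d / 2 ≤ d := Nat.div_le_self d 2
  refine diam_eq_of_forall_dist_le (caterpillar_isTree n d _ hd).connected (fun x y => ?_)
    ⟨Sum.inl 0, Sum.inl (Fin.last d), ?_⟩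
  · rw [caterpillar_dist n d _ hd]
    rcases x with x | x <;> rcases y with y | y <;>
      have := x.2 <;> have := y.2 <;>
      simp only [catPos, catHeight, Nat.dist] <;> split_ifs <;> omega
  · rw [caterpillar_dist n d _ hd]
    simp [catPos, catHeight, Nat.dist, Fin.ext_iff]

theorem caterpillar_isGeodesic (n d i : ℕ) (hi : i ≤ d) :
    IsGeodesic (caterpillar n d i) d (fun k => Sum.inl (Fin.ofNat (d + 1) k)) := by
  intro k hk l hl
  rw [caterpillar_dist n d i hi]
  simp only [catPos, catHeight, Sum.inl.injEq, Fin.ext_iff, Fin.ofNat,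
    Nat.mod_eq_of_lt (Nat.lt_succ_of_le hk), Nat.mod_eq_of_lt (Nat.lt_succ_of_le hl), Nat.dist]
  split_ifs <;> omega

/-- A graph that looks like a caterpillar is isomorphic to it. -/
theorem nonempty_iso_caterpillar {V : Type*} [Fintype V] {T : SimpleGraph V}
    {n d i : ℕ} (hn : Fintype.card V = n) {p : ℕ → V} (hp : IsGeodesic T d p)
    (hout : ∀ w, (∀ k ≤ d, w ≠ p k) → ∀ k ≤ d, T.dist w (p k) = 1 + Nat.dist k i)
    (hadj : ∀ w w', (∀ k ≤ d, w ≠ p k) → (∀ k ≤ d, w' ≠ p k) → ¬ T.Adj w w') :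
    Nonempty (T ≃g caterpillar n d i) := by
  classical
  let P : Finset V := (Finset.range (d + 1)).image p
  have hP : ∀ w, w ∉ P ↔ ∀ k ≤ d, w ≠ p k := by
    intro w
    simp only [P, Finset.mem_image, Finset.mem_range, not_exists, not_and, Nat.lt_succ_iff]
    exact forall₂_congr fun _ _ => ne_comm
  have hcard : P.card = d + 1 := by
    rw [Finset.card_image_of_injOn hp.injOn_range, Finset.card_range]
  have hcard' : Fintype.card {w // w ∉ P} = n - d - 1 := by
    rw [Fintype.card_subtype_compl, Fintype.card_coe, hcard, hn]
    omega
  let q := (Fintype.equivFinOfCardEq hcard').symm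
  let f : Fin (d + 1) ⊕ Fin (n - d - 1) → V := Sum.elim (fun k => p k) (fun k => (q k : V))
  have hq : ∀ k, ∀ l ≤ d, (q k : V) ≠ p l := fun k => (hP _).1 (q k).2
  have hf : Function.Bijective f := by
    constructor
    · rintro (a | a) (b | b) h
      · exact congrArg Sum.inl (Fin.ext (hp.injOn (Nat.lt_succ_iff.1 a.2) (Nat.lt_succ_iff.1 b.2) h))
      · exact absurd h.symm (hq b a (Nat.lt_succ_iff.1 a.2))
      · exact absurd h (hq a b (Nat.lt_succ_iff.1 b.2))
      · exact congrArg Sum.inr (q.injective (Subtype.ext h))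
    · intro w
      by_cases hw : w ∈ P
      · obtain ⟨k, hk, rfl⟩ := Finset.mem_image.1 hw
        exact ⟨Sum.inl ⟨k, Finset.mem_range.1 hk⟩, rfl⟩
      · exact ⟨Sum.inr (q.symm ⟨w, hw⟩), by simp [f]⟩
  refine ⟨(RelIso.mk (Equiv.ofBijective f hf) ?_ : caterpillar n d i ≃g T).symm⟩
  have hmix : ∀ k, ∀ a : Fin (d + 1), T.Adj (q k) (p a) ↔ (a : ℕ) = i := by
    intro k a
    rw [← dist_eq_one_iff_adj, hout _ (hq k) a (Nat.lt_succ_iff.1 a.2), Nat.dist]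
    omega
  rintro (a | a) (b | b)
  · change T.Adj (p a) (p b) ↔ (pathGraph (d + 1)).Adj a b
    rw [← dist_eq_one_iff_adj, hp a (Nat.lt_succ_iff.1 a.2) b (Nat.lt_succ_iff.1 b.2),
      pathGraph_adj, Nat.dist]
    omega
  · exact T.adj_comm _ _ |>.trans (hmix b a)
  · exact hmix a b
  · exact iff_of_false (hadj _ _ (hq a) (hq b)) id

/-! ### Path sums and their maximum at the centre. -/

/-- The sum of the reciprocals of the distances from the vertices of a path `v_0 … v_d` to a vertex
that lies at distance `h` from the path and projects to `v_j`. -/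
noncomputable def pathSum (d h j : ℕ) : ℝ :=
  ∑ i ∈ Finset.range (d + 1), ((h + Nat.dist i j : ℕ) : ℝ)⁻¹

/-- The shifted harmonic sum `1/2 + ⋯ + 1/(k + 1)`. -/
noncomputable def shiftedHarmonic (k : ℕ) : ℝ :=
  ∑ i ∈ Finset.range k, ((i : ℝ) + 2)⁻¹

theorem pathSum_one (j c : ℕ) :
    pathSum (j + c) 1 j = 1 + shiftedHarmonic j + shiftedHarmonic c := by
  unfold pathSum shiftedHarmonic
  rw [add_assoc j c 1, Finset.sum_range_add, Finset.sum_range_succ', ← Finset.sum_range_reflect]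
  have h1 : ∀ i ∈ Finset.range j, ((1 + Nat.dist (j - 1 - i) j : ℕ) : ℝ)⁻¹ = ((i : ℝ) + 2)⁻¹ := by
    intro i hi
    have hi := Finset.mem_range.1 hi
    have : 1 + Nat.dist (j - 1 - i) j = i + 2 := by
      rw [Nat.dist]
      omega
    rw [this]
    push_cast
    rfl
  have h2 : ∀ i ∈ Finset.range c, ((1 + Nat.dist (j + (i + 1)) j : ℕ) : ℝ)⁻¹ = ((i : ℝ) + 2)⁻¹ := by
    intro i _
    have : 1 + Nat.dist (j + (i + 1)) j = i + 2 := by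
      rw [Nat.dist]
      omega
    rw [this]
    push_cast
    rfl
  rw [Finset.sum_congr rfl h1, Finset.sum_congr rfl h2]
  simp only [add_zero, Nat.dist_self, Nat.cast_one, inv_one]
  ring

/-- Concavity: balancing the two lengths trades the last terms of the longer sum for larger ones. -/
theorem shiftedHarmonic_add_lt {j c k l : ℕ} (hjk : j < k) (hkl : k ≤ l) (h : j + c = k + l) :
    shiftedHarmonic j + shiftedHarmonic c < shiftedHarmonic k + shiftedHarmonic l := by
  obtain ⟨t, rfl⟩ : ∃ t, k = j + (t + 1) := ⟨k - j - 1, by omega⟩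
  obtain rfl : c = l + (t + 1) := by omega
  unfold shiftedHarmonic
  rw [Finset.sum_range_add _ j, Finset.sum_range_add _ l]
  have : ∑ x ∈ Finset.range (t + 1), (((l + x : ℕ) : ℝ) + 2)⁻¹ <
      ∑ x ∈ Finset.range (t + 1), (((j + x : ℕ) : ℝ) + 2)⁻¹ := by
    refine Finset.sum_lt_sum_of_nonempty (by simp) fun x _ => ?_
    have : ((j + x : ℕ) : ℝ) < ((l + x : ℕ) : ℝ) := by
      exact_mod_cast (by omega : j + x < l + x)
    gcongr
  linarith

theorem pathSum_one_lt {d j : ℕ} (hj : j ≤ d) (h1 : j ≠ d / 2) (h2 : j ≠ d - d / 2) :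
    pathSum d 1 j < pathSum d 1 (d / 2) := by
  obtain ⟨c, rfl⟩ := Nat.exists_eq_add_of_le hj
  have key : pathSum (j + c) 1 ((j + c) / 2) =
      1 + shiftedHarmonic ((j + c) / 2) + shiftedHarmonic (j + c - (j + c) / 2) := by
    rw [← pathSum_one]
    congr 1
    omega
  rw [key, pathSum_one]
  by_cases h : j < (j + c) / 2
  · have := shiftedHarmonic_add_lt (j := j) (c := c) (l := j + c - (j + c) / 2) h
      (by omega) (by omega)
    linarith
  · have := shiftedHarmonic_add_lt (j := c) (c := j) (k := (j + c) / 2)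
      (l := j + c - (j + c) / 2) (by omega) (by omega) (by omega)
    linarith

theorem pathSum_one_reflect (d : ℕ) : pathSum d 1 (d - d / 2) = pathSum d 1 (d / 2) := by
  have h1 := pathSum_one (d - d / 2) (d / 2)
  have h2 := pathSum_one (d / 2) (d - d / 2)
  rw [show d - d / 2 + d / 2 = d by omega] at h1
  rw [show d / 2 + (d - d / 2) = d by omega] at h2
  linarith

theorem pathSum_one_le {d j : ℕ} (hj : j ≤ d) : pathSum d 1 j ≤ pathSum d 1 (d / 2) := by
  by_cases h1 : j = d / 2
  · rw [h1]
  by_cases h2 : j = d - d / 2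
  · rw [h2, pathSum_one_reflect]
  exact (pathSum_one_lt hj h1 h2).le

/-- The term of `v_j` drops from 1 to at most 1/2, and all others drop strictly; `0 < j` ensures
that there is another one. -/
theorem pathSum_add_half_lt {d h j : ℕ} (hh : 2 ≤ h) (hj : j ≤ d) (hj0 : 0 < j) :
    pathSum d h j + 1 / 2 < pathSum d 1 j := by
  have hsplit : ∀ f : ℕ → ℝ, ∑ i ∈ Finset.range (d + 1), f i =
      f j + ∑ i ∈ (Finset.range (d + 1)).erase j, f i := fun f =>
    (Finset.add_sum_erase _ f (Finset.mem_range.2 (by omega))).symm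
  have hlt : ∀ i, ((h + Nat.dist i j : ℕ) : ℝ)⁻¹ < ((1 + Nat.dist i j : ℕ) : ℝ)⁻¹ := by
    intro i
    have h1 : (0 : ℝ) < ((1 + Nat.dist i j : ℕ) : ℝ) := by positivity
    have h2 : ((1 + Nat.dist i j : ℕ) : ℝ) < ((h + Nat.dist i j : ℕ) : ℝ) := by
      exact_mod_cast (by omega : 1 + Nat.dist i j < h + Nat.dist i j)
    gcongr
  have hsum : ∑ i ∈ (Finset.range (d + 1)).erase j, ((h + Nat.dist i j : ℕ) : ℝ)⁻¹ <
      ∑ i ∈ (Finset.range (d + 1)).erase j, ((1 + Nat.dist i j : ℕ) : ℝ)⁻¹ :=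
    Finset.sum_lt_sum_of_nonempty ⟨0, by simp; omega⟩ fun i _ => hlt i
  have hinv : (h : ℝ)⁻¹ ≤ 2⁻¹ := by
    have : (2 : ℝ) ≤ h := by exact_mod_cast hh
    gcongr
  unfold pathSum
  rw [hsplit, hsplit fun i => ((1 + Nat.dist i j : ℕ) : ℝ)⁻¹]
  simp only [Nat.dist_self, add_zero, Nat.cast_one, inv_one]
  linarith

/-! ### Charging off-path edges to their lower endpoints. -/

section Tree

variable {V : Type*} [Fintype V] [DecidableEq V] {T : SimpleGraph V}

/-- The vertices off the path `p 0, …, p d`. -/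
def offPath (d : ℕ) (p : ℕ → V) : Finset V := ((Finset.range (d + 1)).image p)ᶜ

theorem mem_offPath {d : ℕ} {p : ℕ → V} {w : V} : w ∈ offPath d p ↔ ∀ k ≤ d, w ≠ p k := by
  simp only [offPath, Finset.mem_compl, Finset.mem_image, Finset.mem_range, not_exists, not_and,
    Nat.lt_succ_iff]
  exact forall₂_congr fun _ _ => ne_comm

theorem IsGeodesic.card_offPath {d : ℕ} {p : ℕ → V} (hp : IsGeodesic T d p) :
    (offPath d p).card = Fintype.card V - d - 1 := by
  rw [offPath, Finset.card_compl, Finset.card_image_of_injOn hp.injOn_range, Finset.card_range]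
  omega

theorem IsGeodesic.two_mul_hararyIndex {d : ℕ} {p : ℕ → V} (hp : IsGeodesic T d p) :
    2 * hararyIndex T = ∑ i ∈ Finset.range (d + 1), ∑ k ∈ Finset.range (d + 1), (Nat.dist i k : ℝ)⁻¹
      + ∑ w ∈ offPath d p, 2 * ∑ i ∈ Finset.range (d + 1), (T.dist w (p i) : ℝ)⁻¹
      + ∑ w ∈ offPath d p, ∑ w' ∈ offPath d p, (T.dist w w' : ℝ)⁻¹ := by
  have hsplit : ∀ f : V → ℝ, ∑ v, f v =
      ∑ i ∈ Finset.range (d + 1), f (p i) + ∑ w ∈ offPath d p, f w := by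
    intro f
    rw [offPath, ← Finset.sum_add_sum_compl ((Finset.range (d + 1)).image p),
      Finset.sum_image hp.injOn_range]
  have hpp : ∑ i ∈ Finset.range (d + 1), ∑ k ∈ Finset.range (d + 1), (T.dist (p i) (p k) : ℝ)⁻¹ =
      ∑ i ∈ Finset.range (d + 1), ∑ k ∈ Finset.range (d + 1), (Nat.dist i k : ℝ)⁻¹ := by
    refine Finset.sum_congr rfl fun i hi => Finset.sum_congr rfl fun k hk => ?_
    rw [hp i (Nat.lt_succ_iff.1 (Finset.mem_range.1 hi)) k
      (Nat.lt_succ_iff.1 (Finset.mem_range.1 hk))]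
  have hcomm : ∑ i ∈ Finset.range (d + 1), ∑ w ∈ offPath d p, (T.dist (p i) w : ℝ)⁻¹ =
      ∑ w ∈ offPath d p, ∑ i ∈ Finset.range (d + 1), (T.dist w (p i) : ℝ)⁻¹ := by
    rw [Finset.sum_comm]
    simp only [T.dist_comm]
  simp only [hararyIndex, reciprocalDistMatrix, Matrix.of_apply, hsplit, Finset.sum_add_distrib,
    hpp, hcomm, ← Finset.mul_sum]
  ring

/-- The neighbours of `w` off the path `p 0, …, p d` that are closer to `p 0` than `w` is. -/
noncomputable def offPathParents (T : SimpleGraph V) (d : ℕ) (p : ℕ → V) (w : V) : Finset V :=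
  open Classical in
  (offPath d p).filter fun w' => T.Adj w' w ∧ T.dist (p 0) w' + 1 = T.dist (p 0) w

theorem mem_offPathParents {d : ℕ} {p : ℕ → V} {w w' : V} : w' ∈ offPathParents T d p w ↔
    w' ∈ offPath d p ∧ T.Adj w' w ∧ T.dist (p 0) w' + 1 = T.dist (p 0) w := by
  simp [offPathParents]

theorem card_offPathParents_le_one (hT : T.IsTree) (d : ℕ) (p : ℕ → V) (w : V) :
    (offPathParents T d p w).card ≤ 1 := by
  refine Finset.card_le_one.2 fun a ha b hb => ?_
  obtain ⟨-, ha1, ha2⟩ := mem_offPathParents.1 ha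
  obtain ⟨-, hb1, hb2⟩ := mem_offPathParents.1 hb
  exact eq_of_adj_of_dist_succ hT ha1 hb1 ha2 hb2

/-- The only neighbour of `w` closer to `p 0` is `p j`, which lies on the path. -/
theorem offPathParents_eq_empty (hT : T.IsTree) {d : ℕ} {p : ℕ → V} (hp : IsGeodesic T d p)
    {w : V} {j : ℕ} (hj : j ≤ d) (hw : ∀ i ≤ d, T.dist w (p i) = 1 + Nat.dist i j) :
    offPathParents T d p w = ∅ := by
  refine Finset.eq_empty_of_forall_notMem fun w' hw' => ?_
  obtain ⟨h0, h1, h2⟩ := mem_offPathParents.1 hw'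
  refine mem_offPath.1 h0 j hj (eq_of_adj_of_dist_succ hT h1 ?_ h2 ?_)
  · rw [← dist_eq_one_iff_adj, T.dist_comm, hw j hj, Nat.dist_self]
  · rw [hp 0 (Nat.zero_le d) j hj, T.dist_comm, hw 0 (Nat.zero_le d)]
    exact add_comm _ _

/-- The contribution of a vertex off a diametral path, increased by the excess that comes from its
parent, is largest for a pendant vertex attached to the centre of the path. -/
theorem offPath_contribution (hT : T.IsTree) {d : ℕ} (hd : ∀ x y, T.dist x y ≤ d) {p : ℕ → V}
    (hp : IsGeodesic T d p) {w : V} (hw : w ∈ offPath d p) :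
    2 * ∑ i ∈ Finset.range (d + 1), (T.dist w (p i) : ℝ)⁻¹ + (offPathParents T d p w).card ≤
        2 * pathSum d 1 (d / 2) ∧
      (2 * ∑ i ∈ Finset.range (d + 1), (T.dist w (p i) : ℝ)⁻¹ + (offPathParents T d p w).card =
          2 * pathSum d 1 (d / 2) →
        ∃ j, (j = d / 2 ∨ j = d - d / 2) ∧ ∀ i ≤ d, T.dist w (p i) = 1 + Nat.dist i j) := by
  obtain ⟨j, hj, hproj⟩ := hp.exists_proj hT w
  have hsum : ∑ i ∈ Finset.range (d + 1), (T.dist w (p i) : ℝ)⁻¹ =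
      pathSum d (T.dist w (p j)) j := by
    refine Finset.sum_congr rfl fun i hi => ?_
    rw [hproj i (Nat.lt_succ_iff.1 (Finset.mem_range.1 hi))]
  have hpos : 0 < T.dist w (p j) := hT.connected.pos_dist_of_ne (mem_offPath.1 hw j hj)
  have hle := pathSum_one_le hj
  rw [hsum]
  by_cases h : T.dist w (p j) = 1
  · rw [h] at hproj ⊢
    rw [offPathParents_eq_empty hT hp hj hproj, Finset.card_empty, Nat.cast_zero, add_zero]
    refine ⟨by linarith, fun heq => ⟨j, ?_, hproj⟩⟩
    by_contra! hne
    have := pathSum_one_lt hj hne.1 hne.2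
    linarith
  · have hend := hproj d le_rfl
    have hend' := hd w (p d)
    rw [Nat.dist] at hend
    -- The distance from `w` to `p d` is its height plus `d - j`, so the diameter bound forces `j`
    -- to be at least the height.
    have hlt := pathSum_add_half_lt (by omega : 2 ≤ T.dist w (p j)) hj (by omega)
    have hcard : ((offPathParents T d p w).card : ℝ) ≤ 1 := by
      exact_mod_cast card_offPathParents_le_one hT d p w
    exact ⟨by linarith, fun heq => by linarith⟩

/-- For adjacent vertices the value is 1 = 1/2 + 1/2: their distances to `p 0` differ by one, so one
is the parent of the other. -/
theorem inv_dist_le (hT : T.IsTree) {d : ℕ} {p : ℕ → V} {w w' : V} (hw : w ∈ offPath d p)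
    (hw' : w' ∈ offPath d p) :
    (T.dist w w' : ℝ)⁻¹ ≤ (if w = w' then 0 else 1 / 2) +
      (if w' ∈ offPathParents T d p w then 1 / 2 else 0) +
      (if w ∈ offPathParents T d p w' then 1 / 2 else 0) := by
  by_cases heq : w = w'
  · subst heq
    rw [dist_self, Nat.cast_zero, inv_zero]
    split_ifs <;> norm_num
  rw [if_neg heq]
  by_cases hadj : T.Adj w w'
  · rw [dist_eq_one_iff_adj.2 hadj]
    rcases hT.dist_eq_dist_add_one_of_adj (p 0) hadj with h | h
    · rw [if_pos (mem_offPathParents.2 ⟨hw', hadj.symm, h.symm⟩)]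
      split_ifs <;> norm_num
    · rw [if_pos (mem_offPathParents.2 ⟨hw, hadj, h.symm⟩)]
      split_ifs <;> norm_num
  · have h := hT.connected.one_lt_dist_of_ne_of_not_adj heq hadj
    have h2 : (2 : ℝ) ≤ T.dist w w' := by exact_mod_cast h
    have : (T.dist w w' : ℝ)⁻¹ ≤ 2⁻¹ := by gcongr
    split_ifs <;> linarith

theorem sum_offPath_bound (T : SimpleGraph V) (d : ℕ) (p : ℕ → V) :
    ∑ w ∈ offPath d p, ∑ w' ∈ offPath d p, ((if w = w' then (0 : ℝ) else 1 / 2) +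
      (if w' ∈ offPathParents T d p w then 1 / 2 else 0) +
      (if w ∈ offPathParents T d p w' then 1 / 2 else 0)) =
    ∑ w ∈ offPath d p, ∑ w' ∈ offPath d p, (if w = w' then (0 : ℝ) else 1 / 2) +
      ∑ w ∈ offPath d p, ((offPathParents T d p w).card : ℝ) := by
  have hcard : ∀ w, ∑ w' ∈ offPath d p, (if w' ∈ offPathParents T d p w then (1 / 2 : ℝ) else 0) =
      (offPathParents T d p w).card / 2 := by
    intro w
    rw [← Finset.sum_filter, Finset.filter_mem_eq_inter, Finset.inter_eq_right.2 fun x hx =>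
      (mem_offPathParents.1 hx).1, Finset.sum_const, nsmul_eq_mul]
    ring
  simp only [Finset.sum_add_distrib]
  rw [Finset.sum_comm (f := fun w w' => if w ∈ offPathParents T d p w' then (1 / 2 : ℝ) else 0)]
  simp only [hcard, ← Finset.sum_div]
  ring

end Tree

/-! ### Isomorphism invariance and the value for the caterpillar. -/

theorem dist_iso {V W : Type*} {G : SimpleGraph V} {H : SimpleGraph W} (hG : G.Connected)
    (f : G ≃g H) (x y : V) : H.dist (f x) (f y) = G.dist x y := by
  have hH : H.Connected := f.connected_iff.1 hG
  refine le_antisymm ?_ ?_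
  · obtain ⟨q, hq⟩ := hG.exists_walk_length_eq_dist x y
    rw [← hq, ← Walk.length_map f.toHom q]
    exact dist_le _
  · obtain ⟨q, hq⟩ := hH.exists_walk_length_eq_dist (f x) (f y)
    rw [← hq, ← Walk.length_map f.symm.toHom q]
    have := dist_le (q.map f.symm.toHom)
    simpa using this

theorem hararyIndex_iso {V W : Type*} [Fintype V] [Fintype W] {G : SimpleGraph V}
    {H : SimpleGraph W} (hG : G.Connected) (f : G ≃g H) : hararyIndex G = hararyIndex H := by
  simp only [hararyIndex, reciprocalDistMatrix, Matrix.of_apply]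
  congr 1
  refine Fintype.sum_equiv f.toEquiv _ _ fun x => Fintype.sum_equiv f.toEquiv _ _ fun y => ?_
  exact congrArg (fun k : ℕ => (k : ℝ)⁻¹) (dist_iso hG f x y).symm

/-- Twice the largest Harary index of a tree with a diametral path `v_0 … v_d` and `m` further
vertices. -/
noncomputable def twiceMaxHarary (d m : ℕ) : ℝ :=
  ∑ i ∈ Finset.range (d + 1), ∑ k ∈ Finset.range (d + 1), (Nat.dist i k : ℝ)⁻¹ +
    m * (2 * pathSum d 1 (d / 2)) + m * ((m - 1) / 2)

theorem sum_sum_ite_eq_half {V : Type*} [DecidableEq V] (s : Finset V) :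
    ∑ w ∈ s, ∑ w' ∈ s, (if w = w' then (0 : ℝ) else 1 / 2) = s.card * ((s.card - 1) / 2) := by
  rw [← nsmul_eq_mul]
  refine Finset.sum_eq_card_nsmul fun w hw => ?_
  have h : ∀ w', (if w = w' then (0 : ℝ) else 1 / 2) = 1 / 2 - (if w = w' then 1 / 2 else 0) := by
    intro w'
    split_ifs <;> norm_num
  simp only [h, Finset.sum_sub_distrib, Finset.sum_ite_eq, if_pos hw, Finset.sum_const,
    nsmul_eq_mul]
  ring

theorem two_mul_hararyIndex_caterpillar (n d : ℕ) :
    2 * hararyIndex (caterpillar n d (d / 2)) = twiceMaxHarary d (n - d - 1) := by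
  classical
  have hd : d / 2 ≤ d := Nat.div_le_self d 2
  have hp := caterpillar_isGeodesic n d _ hd
  have hoff : ∀ w ∈ offPath d (fun k => (Sum.inl (Fin.ofNat (d + 1) k) :
      Fin (d + 1) ⊕ Fin (n - d - 1))), ∃ k, w = Sum.inr k := by
    rintro (w | w) hw
    · refine absurd ?_ (mem_offPath.1 hw w (Nat.lt_succ_iff.1 w.2))
      simp
    · exact ⟨w, rfl⟩
  have hcard := hp.card_offPath
  have hcard' : Fintype.card (Fin (d + 1) ⊕ Fin (n - d - 1)) - d - 1 = n - d - 1 := by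
    simp only [Fintype.card_sum, Fintype.card_fin]
    omega
  rw [hcard'] at hcard
  rw [hp.two_mul_hararyIndex, congrArg (twiceMaxHarary d) hcard.symm, twiceMaxHarary,
    ← sum_sum_ite_eq_half, ← nsmul_eq_mul]
  congr 1
  · congr 1
    refine Finset.sum_eq_card_nsmul fun w hw => ?_
    obtain ⟨w, rfl⟩ := hoff w hw
    congr 1
    refine Finset.sum_congr rfl fun i hi => ?_
    rw [caterpillar_dist n d _ hd, if_neg (by simp)]
    simp only [catPos, catHeight, Fin.ofNat, Nat.mod_eq_of_lt (Finset.mem_range.1 hi)]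
    rw [Nat.dist_comm, add_zero, add_comm]
  · refine Finset.sum_congr rfl fun w hw => Finset.sum_congr rfl fun w' hw' => ?_
    obtain ⟨w, rfl⟩ := hoff w hw
    obtain ⟨w', rfl⟩ := hoff w' hw'
    rw [caterpillar_dist n d _ hd]
    simp only [catPos, catHeight, Nat.dist_self]
    split_ifs <;> norm_num

/-! ### The upper bound and its equality case. -/

section Tree

variable {V : Type*} [Fintype V] [DecidableEq V] {T : SimpleGraph V}

/-- The parent counts enter both summed estimates and cancel, so equality in total forces equality
in every term. -/
theorem two_mul_hararyIndex_le (hT : T.IsTree) {d : ℕ} (hd : ∀ x y, T.dist x y ≤ d) {p : ℕ → V}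
    (hp : IsGeodesic T d p) :
    2 * hararyIndex T ≤ twiceMaxHarary d (offPath d p).card ∧
      (2 * hararyIndex T = twiceMaxHarary d (offPath d p).card →
        (∀ w ∈ offPath d p, ∃ j, (j = d / 2 ∨ j = d - d / 2) ∧
          ∀ i ≤ d, T.dist w (p i) = 1 + Nat.dist i j) ∧
        ∀ w ∈ offPath d p, ∀ w' ∈ offPath d p, w ≠ w' → T.dist w w' = 2) := by
  have h1 : ∀ w ∈ offPath d p, _ := fun w hw => (offPath_contribution hT hd hp hw).1
  have hs1 := Finset.sum_le_sum h1
  have h2 : ∀ w ∈ offPath d p, ∀ w' ∈ offPath d p, _ := fun w hw w' hw' =>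
    inv_dist_le hT (d := d) (p := p) hw hw'
  have hs2 := Finset.sum_le_sum fun w hw => Finset.sum_le_sum (h2 w hw)
  have hb := sum_offPath_bound T d p
  rw [sum_sum_ite_eq_half] at hb
  rw [Finset.sum_const, Finset.sum_add_distrib, nsmul_eq_mul] at hs1
  rw [hp.two_mul_hararyIndex, twiceMaxHarary]
  refine ⟨by linarith, fun heq => ?_⟩
  have he1 : ∀ w ∈ offPath d p, ∃ j, (j = d / 2 ∨ j = d - d / 2) ∧
      ∀ i ≤ d, T.dist w (p i) = 1 + Nat.dist i j := by
    intro w hw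
    refine (offPath_contribution hT hd hp hw).2 ((Finset.sum_eq_sum_iff_of_le h1).1 ?_ w hw)
    rw [Finset.sum_const, Finset.sum_add_distrib, nsmul_eq_mul]
    linarith
  refine ⟨he1, fun w hw w' hw' hne => ?_⟩
  have hs3 := (Finset.sum_eq_sum_iff_of_le fun w hw => Finset.sum_le_sum (h2 w hw)).1
    (by linarith) w hw
  have hs4 := (Finset.sum_eq_sum_iff_of_le (h2 w hw)).1 hs3 w' hw'
  have hempty : ∀ v ∈ offPath d p, offPathParents T d p v = ∅ := by
    intro v hv
    obtain ⟨j, hj, hproj⟩ := he1 v hv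
    exact offPathParents_eq_empty hT hp (by omega) hproj
  rw [hempty w hw, hempty w' hw'] at hs4
  simp only [if_neg hne, Finset.notMem_empty, if_false, add_zero, one_div, inv_inj] at hs4
  exact_mod_cast hs4

theorem nonempty_iso_of_two_mul_hararyIndex_eq (hT : T.IsTree) {d : ℕ}
    (hd : ∀ x y, T.dist x y ≤ d) {p : ℕ → V} (hp : IsGeodesic T d p)
    (heq : 2 * hararyIndex T = twiceMaxHarary d (offPath d p).card) :
    Nonempty (T ≃g caterpillar (Fintype.card V) d (d / 2)) := by
  obtain ⟨h1, h2⟩ := (two_mul_hararyIndex_le hT hd hp).2 heq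
  have hadj : ∀ w ∈ offPath d p, ∀ w' ∈ offPath d p, ¬ T.Adj w w' := by
    intro w hw w' hw' h
    have := h2 w hw w' hw' h.ne
    rw [dist_eq_one_iff_adj.2 h] at this
    omega
  obtain ⟨j, hj, hall⟩ : ∃ j, (j = d / 2 ∨ j = d - d / 2) ∧
      ∀ w ∈ offPath d p, ∀ i ≤ d, T.dist w (p i) = 1 + Nat.dist i j := by
    rcases (offPath d p).eq_empty_or_nonempty with h0 | ⟨w, hw⟩
    · exact ⟨d / 2, Or.inl rfl, fun w hw => by simp [h0] at hw⟩
    obtain ⟨j, hj, hproj⟩ := h1 w hw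
    refine ⟨j, hj, fun w' hw' => ?_⟩
    by_cases hne : w = w'
    · exact hne ▸ hproj
    obtain ⟨j', hj', hproj'⟩ := h1 w' hw'
    have hdist := hproj j (by omega)
    have hdist' := hproj' j' (by omega)
    rw [Nat.dist_self] at hdist hdist'
    -- The midpoint of `w` and `w'` cannot be off the path, where no two vertices are adjacent;
    -- being on it, it is the projection of both.
    obtain ⟨q, hq⟩ := hT.connected.exists_walk_length_eq_dist w w'
    rw [h2 w hw w' hw' hne] at hq
    have ha : T.Adj w (q.getVert 1) := by
      simpa using q.adj_getVert_succ (i := 0) (by omega)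
    have hb : T.Adj (q.getVert 1) w' := by
      have hlast : q.getVert (1 + 1) = w' := q.getVert_of_length_le hq.le
      have hstep := q.adj_getVert_succ (i := 1) (by omega)
      simpa only [hlast] using hstep
    have hmem : q.getVert 1 ∉ offPath d p := fun h => hadj w hw _ h ha
    rw [mem_offPath] at hmem
    push Not at hmem
    obtain ⟨k, hk, hqk⟩ := hmem
    rw [hqk] at ha hb
    have e1 := hproj k hk
    have e2 := hproj' k hk
    rw [dist_eq_one_iff_adj.2 ha] at e1
    rw [dist_eq_one_iff_adj.2 hb.symm] at e2
    have f1 : k = j := Nat.eq_of_dist_eq_zero (by omega)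
    have f2 : k = j' := Nat.eq_of_dist_eq_zero (by omega)
    rw [← f1, f2]
    exact hproj'
  rcases hj with rfl | rfl
  · exact nonempty_iso_caterpillar rfl hp (fun w hw => hall w (mem_offPath.2 hw))
      fun w w' hw hw' => hadj w (mem_offPath.2 hw) w' (mem_offPath.2 hw')
  -- Reversing the path moves the attachment index `d - d / 2` to `d / 2`.
  · have hmem : ∀ w, (∀ k ≤ d, w ≠ p (d - k)) → w ∈ offPath d p := by
      intro w hw
      refine mem_offPath.2 fun k hk => ?_
      have := hw (d - k) (by omega)
      rwa [Nat.sub_sub_self hk] at this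
    refine nonempty_iso_caterpillar rfl hp.reverse (fun w hw k hk => ?_)
      fun w w' hw hw' => hadj w (hmem w hw) w' (hmem w' hw')
    rw [hall w (hmem w hw) (d - k) (by omega), Nat.dist, Nat.dist]
    omega

end Tree

end HararyTree

theorem theorem3p7 (n d : ℕ) (hnd : (2 ≤ d ∧ d + 1 ≤ n) ∨ (d ≤ 1 ∧ n = d + 1)) :
    (Fintype.card (Fin (d + 1) ⊕ Fin (n - d - 1)) = n ∧
      (HararyTree.caterpillar n d (d / 2)).IsTree ∧
      (HararyTree.caterpillar n d (d / 2)).diam = d) ∧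
    ∀ (V : Type*) [Fintype V] (T : SimpleGraph V),
      Fintype.card V = n → T.IsTree → T.diam = d →
        HararyTree.hararyIndex T ≤ HararyTree.hararyIndex (HararyTree.caterpillar n d (d / 2)) ∧
        (HararyTree.hararyIndex T = HararyTree.hararyIndex (HararyTree.caterpillar n d (d / 2)) ↔
          Nonempty (T ≃g HararyTree.caterpillar n d (d / 2))) := by
  refine ⟨⟨?_, HararyTree.caterpillar_isTree n d _ (Nat.div_le_self d 2),
    HararyTree.caterpillar_diam n d (by omega)⟩, ?_⟩
  · simp only [Fintype.card_sum, Fintype.card_fin]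
    omega
  · intro V _ T hn hT hdiam
    classical
    have := hT.connected.nonempty
    obtain ⟨p, hp⟩ := HararyTree.exists_isGeodesic hT.connected
    have hd : ∀ x y, T.dist x y ≤ d := fun x y =>
      hdiam ▸ SimpleGraph.dist_le_diam (SimpleGraph.connected_iff_ediam_ne_top.1 hT.connected)
    rw [hdiam] at hp
    have hcat := HararyTree.two_mul_hararyIndex_caterpillar n d
    have hle := (HararyTree.two_mul_hararyIndex_le hT hd hp).1
    have hcard := hp.card_offPath
    rw [hn] at hcard
    rw [hcard] at hle
    refine ⟨by linarith, fun heq => ?_, fun ⟨f⟩ => HararyTree.hararyIndex_iso hT.connected f⟩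
    subst hn
    exact HararyTree.nonempty_iso_of_two_mul_hararyIndex_eq hT hd hp (by rw [hcard, ← hcat, heq])
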